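/- **Corollary (Risk bounds for $\mathcal G_{\mathrm{cov}}$).** There is an absolute constant $C>0$ such that the following holds for every $d$, every closed non-empty $\mathcal Z\subseteq\mathbb R^d$ (with the Euclidean norm), every $\rho\ge 0$ and every $\varepsilon\in[0,0.49]$. *Notation.* $\mathcal P(\mathcal Z)$ is the set of Borel probability measures on $\mathcal Z$. Put $\|\mu-\nu\|_{\mathrm{tv}}=\frac12|\mu-\nu|(\mathcal Z)$, $\mathsf W_p(\mu,\nu)=\inf_{\pi}\big(\mathbb E_\pi\|X-Y\|^p\big)^{1/p}$ over couplings $\pi$ of $\mu,\nu$, and $\mathsf W_p^\varepsilon(\mu,\nu)=\inf\{\mathsf W_p(\mu',\nu):\mu'\in\mathcal P(\mathcal Z),\ \|\mu'-\mu\|_{\mathrm{tv}}\le\varepsilon\}$. Let $\mathcal G_{\mathrm{cov}}$ be the set of $\mu\in\mathcal P(\mathcal Z)$ with finite second moment and covariance matrix $\Sigma_\mu\preceq I_d$. *Setting.* Let $p\in\{1,2\}$, let $\mathcal L$ be a family of lower semicontinuous functions $\ell:\mathcal Z\to\mathbb R$ with $\sup_{z\in\mathcal Z}\frac{\ell(z)}{1+\|z\|^p}<\infty$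 for each $\ell\in\mathcal L$, and let $\mathcal G\subseteq\mathcal G_{\mathrm{cov}}$. Let $\mu\in\mathcal G$ and $\tilde\mu\in\mathcal P(\mathcal Z)$ with $\mathsf W_p^\varepsilon(\tilde\mu,\mu)\le\rho$. Let $\hat\ell\in\mathcal L$ be a minimizer of the outlier-robust Wasserstein DRO (OR-WDRO) problem $$\inf_{\ell\in\mathcal L}\ \sup_{\nu\in\mathcal G:\ \mathsf W_p^\varepsilon(\tilde\mu,\nu)\le\rho}\mathbb E_\nu[\ell],$$ and let $\ell_\star\in\mathcal L$ minimize $\mathbb E_\mu[\ell]$ over $\ell\in\mathcal L$ (expectations take values in $[-\infty,\infty)$). *Conclusion.* - If $p=1$ and $\ell_\star$ is Lipschitz, with least Lipschitz constant $\|\ell_\star\|_{\mathrm{Lip}}$, then $$\mathbb E_\mu[\hat\ell]-\mathbb E_\mu[\ell_\star]\le C\,\|\ell_\star\|_{\mathrm{Lip}}\big(\rho+\sqrt{d\varepsilon}\big).$$ - If $p=2$ and $\ell_\star$ is $\alpha$-smooth for some $\alpha\ge0$, then $$\mathbb E_\mu[\hat\ell]-\mathbb E_\mu[\ell_\star]\le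 C\Big(\|\ell_\star\|_{\dot H^{1,2}(\mu)}\big(\rho+\sqrt d\big)+\alpha\,(\rho^2+d)\Big),\qquad \|\ell_\star\|_{\dot H^{1,2}(\mu)}=\mathbb E_\mu\big[\|\nabla\ell_\star\|^2\big]^{1/2}.$$ Here $\ell_\star$ is called $\alpha$-smooth if it extends to a differentiable function on the convex hull of $\mathcal Z$ (differentiable relative to the hull) having an $\alpha$-Lipschitz gradient there, and $\nabla\ell_\star$ is the restriction of this gradient to $\mathcal Z$. If $\mathcal Z$ is convex, for example $\mathcal Z=\mathbb R^d$, this means that $\ell_\star$ is continuously differentiable on $\mathcal Z$ with $\|\nabla\ell_\star(z)-\nabla\ell_\star(z')\|\le\alpha\|z-z'\|$ for all $z,z'\in\mathcal Z$. Where the gradient is not unique (when the hull has empty interior), the bound holds for every admissible choice. -/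

import Mathlib

open MeasureTheory ProbabilityTheory Set
open scoped ENNReal NNReal InnerProductSpace

noncomputable section

/-- The total variation norm `‖μ - ν‖_tv = (1/2) |μ - ν|(X)` of the signed measure `μ - ν`. -/
def tvDist {X : Type*} [MeasurableSpace X] (μ ν : ProbabilityMeasure X) : ℝ≥0∞ :=
  ((μ : Measure X).toSignedMeasure - (ν : Measure X).toSignedMeasure).totalVariation univ / 2

/-- The `p`-Wasserstein distance
`W_p(μ, ν) = inf_π (E_π ‖X - Y‖ ^ p) ^ (1 / p)` over all couplings `π` of `μ` and `ν`,
with value in `[0, ∞]`. -/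
def wassersteinDist {X : Type*} [PseudoEMetricSpace X] [MeasurableSpace X]
    (p : ℝ) (μ ν : ProbabilityMeasure X) : ℝ≥0∞ :=
  ⨅ (π : Measure (X × X)) (_ : π.fst = (μ : Measure X) ∧ π.snd = (ν : Measure X)),
    (∫⁻ z, edist z.1 z.2 ^ p ∂π) ^ (1 / p)

/-- The `ε`-outlier-robust `p`-Wasserstein distance
`W_p^ε(μ, ν) = inf { W_p(μ', ν) : ‖μ' - μ‖_tv ≤ ε }`. -/
def robustWassersteinDist {X : Type*} [PseudoEMetricSpace X] [MeasurableSpace X]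
    (p ε : ℝ) (μ ν : ProbabilityMeasure X) : ℝ≥0∞ :=
  ⨅ (μ' : ProbabilityMeasure X) (_ : tvDist μ' μ ≤ ENNReal.ofReal ε), wassersteinDist p μ' ν

/-- The expectation `E_μ[f]`, with value in `[-∞, ∞]`: the integral of the positive part minus
the integral of the negative part. It is the usual extended expectation as soon as one of the two
parts has finite integral; the losses below have a positive part with finite integral. -/
def extExpectation {X : Type*} [MeasurableSpace X] (μ : ProbabilityMeasure X) (f : X → ℝ) :
    EReal :=
  ((∫⁻ x, ENNReal.ofReal (f x) ∂(μ : Measure X) : ℝ≥0∞) : EReal) -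
    ((∫⁻ x, ENNReal.ofReal (-f x) ∂(μ : Measure X) : ℝ≥0∞) : EReal)

/-- The worst-case risk `sup { E_ν[ℓ] : ν ∈ G, W_p^ε(μt, ν) ≤ ρ }`. -/
def worstCaseRisk {X : Type*} [PseudoEMetricSpace X] [MeasurableSpace X]
    (p ρ ε : ℝ) (G : Set (ProbabilityMeasure X)) (μt : ProbabilityMeasure X) (ℓ : X → ℝ) : EReal :=
  ⨆ (ν : ProbabilityMeasure X)
    (_ : ν ∈ G ∧ robustWassersteinDist p ε μt ν ≤ ENNReal.ofReal ρ), extExpectation ν ℓ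

/-- `ℓhat` is a minimizer over `L` of the outlier-robust Wasserstein DRO problem
`inf_{ℓ ∈ L} sup { E_ν[ℓ] : ν ∈ G, W_p^ε(μt, ν) ≤ ρ }`. -/
def IsORWDROMinimizer {X : Type*} [PseudoEMetricSpace X] [MeasurableSpace X]
    (p ρ ε : ℝ) (L : Set (X → ℝ)) (G : Set (ProbabilityMeasure X)) (μt : ProbabilityMeasure X)
    (ℓhat : X → ℝ) : Prop :=
  ℓhat ∈ L ∧ ∀ ℓ ∈ L, worstCaseRisk p ρ ε G μt ℓhat ≤ worstCaseRisk p ρ ε G μt ℓ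

/-- `ℓstar` minimizes the risk `E_μ[ℓ]` over `ℓ ∈ L`. -/
def IsRiskMinimizer {X : Type*} [MeasurableSpace X] (L : Set (X → ℝ)) (μ : ProbabilityMeasure X)
    (ℓstar : X → ℝ) : Prop :=
  ℓstar ∈ L ∧ ∀ ℓ ∈ L, extExpectation μ ℓstar ≤ extExpectation μ ℓ

/-- A family of lower semicontinuous losses on `Z ⊆ ℝ^d` with
`sup_{z ∈ Z} ℓ(z) / (1 + ‖z‖ ^ p) < ∞` for each `ℓ`. -/
def IsLossFamily {d : ℕ} {Z : Set (EuclideanSpace ℝ (Fin d))} (p : ℝ) (L : Set (Z → ℝ)) : Prop :=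
  ∀ ℓ ∈ L, LowerSemicontinuous ℓ ∧
    BddAbove (range fun z : Z => ℓ z / (1 + ‖(z : EuclideanSpace ℝ (Fin d))‖ ^ p))

/-- The covariance matrix `Σ_μ` of a distribution on `Z ⊆ ℝ^d`. -/
def covMatrix {d : ℕ} {Z : Set (EuclideanSpace ℝ (Fin d))} (μ : ProbabilityMeasure Z) :
    Matrix (Fin d) (Fin d) ℝ :=
  Matrix.of fun i j =>
    cov[fun z : Z => (z : EuclideanSpace ℝ (Fin d)) i,
      fun z : Z => (z : EuclideanSpace ℝ (Fin d)) j; (μ : Measure Z)]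

/-- The class `G_cov` of distributions on `Z` with finite second moment and `Σ_μ ⪯ I_d`. -/
def boundedCovClass {d : ℕ} (Z : Set (EuclideanSpace ℝ (Fin d))) : Set (ProbabilityMeasure Z) :=
  {μ | MemLp (fun z : Z => (z : EuclideanSpace ℝ (Fin d))) 2 (μ : Measure Z) ∧
    (1 - covMatrix μ).PosSemidef}

/-- The Lipschitz seminorm: the least Lipschitz constant of a Lipschitz function. -/
def lipSeminorm {X : Type*} [PseudoEMetricSpace X] (f : X → ℝ) : ℝ≥0 :=
  sInf {K : ℝ≥0 | LipschitzWith K f}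

/-- `f : Z → ℝ` is `α`-smooth with gradient `g : Z → ℝ^d`: there is a differentiable extension of
`f` to the convex hull of `Z` whose gradient is `α`-Lipschitz and extends `g`. For convex `Z` this
says that `g` is a gradient of `f` on `Z` and is `α`-Lipschitz there. -/
def IsSmoothWithGradient {d : ℕ} {Z : Set (EuclideanSpace ℝ (Fin d))} (α : ℝ≥0) (f : Z → ℝ)
    (g : Z → EuclideanSpace ℝ (Fin d)) : Prop :=
  ∃ (F : EuclideanSpace ℝ (Fin d) → ℝ)
    (D : EuclideanSpace ℝ (Fin d) → EuclideanSpace ℝ (Fin d)),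
    (∀ z : Z, F z = f z) ∧ (∀ z : Z, D z = g z) ∧
    (∀ x ∈ convexHull ℝ Z, HasGradientWithinAt F (D x) (convexHull ℝ Z) x) ∧
    LipschitzOnWith α D (convexHull ℝ Z)

/-- The homogeneous Sobolev seminorm `E_μ[‖g‖ ^ 2] ^ (1 / 2)` of a function with gradient `g`. -/
def sobolevSeminorm {d : ℕ} {Z : Set (EuclideanSpace ℝ (Fin d))} (μ : ProbabilityMeasure Z)
    (g : Z → EuclideanSpace ℝ (Fin d)) : ℝ :=
  Real.sqrt (∫ z, ‖g z‖ ^ 2 ∂(μ : Measure Z))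

end

/-!
Since `μ` is feasible in the robust problem, the excess risk of the robust minimizer is at most the
supremum of `E_ν[ℓstar] - E_μ[ℓstar]` over feasible `ν`
(`IsORWDROMinimizer.extExpectation_sub_le`). So one has to compare two distributions `μ`, `ν` of bounded covariance that are both within
robust distance `ρ` of the same `μt`.

**Lipschitz losses.** The two robust distances come with perturbations `μ₁`, `μ₂` of `μt`, coupled
with `μ` and `ν` at cost about `ρ`. In total variation `μ₁` and `μ₂` are at most `2 * ε < 1` apart,
so they share a part `κ` of mass `m ≥ 1 - 2 * ε ≥ 1 / 50` (`exists_common_part`). Transported along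
the couplings, `κ` becomes a part of `μ` and a part of `ν`, both of mass `m`. For a `K`-Lipschitz
`f`, transport changes the integral by at most `K * ρ`; and, by Cauchy–Schwarz, the integral of `f`
over a part of mass `m` differs from `m * E[f]` by at most `√(1 - m) * √(Var f)`, where
`Var f ≤ K ^ 2 * d`. Hence `∫ f dκ` is close to both `m * E_μ[f]` and `m * E_ν[f]`
(`integral_sub_mul_le_of_coupling`), and dividing by `m` gives
`|E_ν[f] - E_μ[f]| ≤ C * K * (ρ + √(d * ε))` (`integral_sub_le_of_mem_boundedCovClass`). No optimal
coupling and no gluing of couplings is needed.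

**Smooth losses.** The bound to be proved contains `√d` rather than `√(d * ε)`, so the independent
coupling of `μ` and `ν` is good enough: its squared cost is controlled by the traces of the two
covariances and the distance of the means, and the latter is bounded by the Lipschitz case applied
to a linear functional (`norm_meanVector_sub_le`). A first-order Taylor expansion of `ℓstar` along
this coupling, with Cauchy–Schwarz for the linear term, concludes
(`IsSmoothWithGradient.integral_sub_le`).
-/

/-! ### Total variation and the common part of two probability measures -/

/-- The total variation norm dominates the difference on every event; since the two measures have
equal mass, the factor `1 / 2` in `tvDist` makes the bound `ε` and not `2 * ε`. -/
lemma abs_measureReal_sub_le_of_tvDist_le {X : Type*} [MeasurableSpace X]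
    {μ ν : ProbabilityMeasure X} {ε : ℝ} (hε : 0 ≤ ε) (h : tvDist μ ν ≤ ENNReal.ofReal ε)
    {A : Set X} (hA : MeasurableSet A) :
    |(μ : Measure X).real A - (ν : Measure X).real A| ≤ ε := by
  set s := (μ : Measure X).toSignedMeasure - (ν : Measure X).toSignedMeasure with hs
  set j := s.toJordanDecomposition with hj
  have hsj (B : Set X) (hB : MeasurableSet B) :
      (μ : Measure X).real B - (ν : Measure X).real B = j.posPart.real B - j.negPart.real B := by
    have h1 : s B = (μ : Measure X).real B - (ν : Measure X).real B :=
      Measure.toSignedMeasure_sub_apply hB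
    have h2 : j.toSignedMeasure B = j.posPart.real B - j.negPart.real B :=
      Measure.toSignedMeasure_sub_apply hB
    rw [← h1, ← h2, hj, SignedMeasure.toSignedMeasure_toJordanDecomposition]
  have huniv : j.posPart.real univ = j.negPart.real univ := by
    have := hsj univ MeasurableSet.univ
    simp only [probReal_univ, sub_self] at this
    linarith
  have htv : j.posPart.real univ ≤ ε := by
    have h1 : (s.totalVariation univ / 2).toReal ≤ ε :=
      ENNReal.toReal_le_of_le_ofReal hε h
    have h2 : (s.totalVariation univ).toReal = j.posPart.real univ + j.negPart.real univ := by
      rw [SignedMeasure.totalVariation, Measure.add_apply,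
        ENNReal.toReal_add (measure_ne_top _ _) (measure_ne_top _ _)]
      rfl
    rw [ENNReal.toReal_div, h2] at h1
    norm_num at h1
    linarith
  have hp : j.posPart.real A ≤ j.posPart.real univ := measureReal_mono (subset_univ A)
  have hn : j.negPart.real A ≤ j.negPart.real univ := measureReal_mono (subset_univ A)
  have hp0 : 0 ≤ j.posPart.real A := measureReal_nonneg
  have hn0 : 0 ≤ j.negPart.real A := measureReal_nonneg
  rw [hsj A hA, abs_le]
  constructor <;> linarith

/-- Two probability measures whose values differ by at most `η` on every event have a common part
of mass at least `1 - η`: on each side of a Hahn decomposition, take the smaller measure. -/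
lemma exists_common_part {X : Type*} [MeasurableSpace X] (μ ν : Measure X)
    [IsProbabilityMeasure μ] [IsProbabilityMeasure ν] {η : ℝ}
    (h : ∀ A, MeasurableSet A → μ.real A - ν.real A ≤ η) :
    ∃ κ : Measure X, κ ≤ μ ∧ κ ≤ ν ∧ 1 - η ≤ κ.real univ := by
  obtain ⟨s, hs⟩ := exists_isHahnDecomposition μ ν
  have hsm := hs.measurableSet
  refine ⟨μ.restrict s + ν.restrict sᶜ, ?_, ?_, ?_⟩
  · calc μ.restrict s + ν.restrict sᶜ ≤ μ.restrict s + μ.restrict sᶜ := by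
          exact add_le_add_right hs.ge_on_compl _
      _ = μ := Measure.restrict_add_restrict_compl hsm
  · calc μ.restrict s + ν.restrict sᶜ ≤ ν.restrict s + ν.restrict sᶜ := by
          exact add_le_add_left hs.le_on _
      _ = ν := Measure.restrict_add_restrict_compl hsm
  · rw [measureReal_add_apply, measureReal_restrict_apply_univ, measureReal_restrict_apply_univ]
    have h1 := h sᶜ hsm.compl
    have h2 : μ.real s + μ.real sᶜ = 1 := by
      rw [measureReal_compl hsm, probReal_univ]; ring
    linarith

/-! ### Transporting a part of a measure along a coupling -/

/-- A measure `κ` below the first marginal of `π` is the first marginal of a measure below `π`,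
namely of `π` weighted with the density of `κ`. -/
lemma exists_le_fst_eq {X Y : Type*} [MeasurableSpace X] [MeasurableSpace Y]
    (π : Measure (X × Y)) [IsFiniteMeasure π] (κ : Measure X) (h : κ ≤ π.fst) :
    ∃ π' ≤ π, π'.fst = κ := by
  have : IsFiniteMeasure κ := isFiniteMeasure_of_le _ h
  have hm : Measurable (κ.rnDeriv π.fst) := Measure.measurable_rnDeriv _ _
  have hle : ∀ᵐ x ∂π.fst, κ.rnDeriv π.fst x ≤ 1 := Measure.rnDeriv_le_one_of_le h
  refine ⟨π.withDensity fun z => κ.rnDeriv π.fst z.1, ?_, ?_⟩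
  · calc π.withDensity (fun z => κ.rnDeriv π.fst z.1) ≤ π.withDensity 1 := by
          apply withDensity_mono
          exact ae_of_ae_map measurable_fst.aemeasurable hle
      _ = π := withDensity_one
  · conv_rhs => rw [← Measure.withDensity_rnDeriv_eq κ π.fst (Measure.absolutelyContinuous_of_le h)]
    ext A hA
    rw [Measure.fst_apply hA, withDensity_apply _ (measurable_fst hA), withDensity_apply _ hA,
      show π.fst = π.map Prod.fst from rfl]
    exact (setLIntegral_map hA hm measurable_fst).symm

/-- The Cauchy–Schwarz inequality in `L²`. -/
lemma integral_mul_le_sqrt_mul_sqrt {Ω : Type*} [MeasurableSpace Ω] {P : Measure Ω} {f g : Ω → ℝ}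
    (hf0 : 0 ≤ f) (hg0 : 0 ≤ g) (hf : MemLp f 2 P) (hg : MemLp g 2 P) :
    ∫ x, f x * g x ∂P ≤ √(∫ x, f x ^ 2 ∂P) * √(∫ x, g x ^ 2 ∂P) := by
  have h := integral_mul_le_Lp_mul_Lq_of_nonneg (μ := P) Real.HolderConjugate.two_two
    (Filter.Eventually.of_forall hf0) (Filter.Eventually.of_forall hg0) (by simpa using hf)
    (by simpa using hg)
  simpa [Real.sqrt_eq_rpow] using h

/-- A part `ν'` of a probability measure `ν` changes the mean of `f` by little: the error is carried
by the remaining part, of mass `1 - ν' univ`, and is controlled by the variance. -/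
lemma integral_sub_mul_le_sqrt_variance {Ω : Type*} [MeasurableSpace Ω] (ν ν' : Measure Ω)
    [IsProbabilityMeasure ν] (h : ν' ≤ ν) {f : Ω → ℝ} (hf : MemLp f 2 ν) :
    ∫ x, f x ∂ν' - ν'.real univ * ∫ x, f x ∂ν ≤ √(1 - ν'.real univ) * √(Var[f; ν]) := by
  have : IsFiniteMeasure ν' := isFiniteMeasure_of_le _ h
  set c := ∫ x, f x ∂ν with hc
  set τ := ν - ν' with hτ
  have hadd : τ + ν' = ν := Measure.sub_add_cancel_of_le h
  have hτle : τ ≤ ν := Measure.sub_le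
  have : IsFiniteMeasure τ := isFiniteMeasure_of_le _ hτle
  have hfi : Integrable f ν := hf.integrable one_le_two
  have hg : MemLp (fun x => f x - c) 2 ν := hf.sub (memLp_const c)
  have hgi : Integrable (fun x => f x - c) ν := hg.integrable one_le_two
  have hmass : τ.real univ = 1 - ν'.real univ := by
    have h1 : (τ + ν').real univ = 1 := by rw [hadd]; exact probReal_univ
    rw [measureReal_add_apply] at h1
    linarith
  have hsplit : ∫ x, (f x - c) ∂τ + ∫ x, (f x - c) ∂ν' = 0 := by
    rw [← integral_add_measure (hgi.mono_measure hτle) (hgi.mono_measure h), hadd,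
      integral_sub hfi (integrable_const c)]
    simp [hc]
  have hν' : ∫ x, (f x - c) ∂ν' = ∫ x, f x ∂ν' - ν'.real univ * c := by
    rw [integral_sub (hfi.mono_measure h) (integrable_const c)]
    simp
  have hcs := integral_mul_le_sqrt_mul_sqrt (P := τ) (f := fun _ => (1 : ℝ))
    (g := fun x => |f x - c|) (fun _ => zero_le_one) (fun x => abs_nonneg _) (memLp_const 1)
    ((hg.mono_measure hτle).abs)
  have hvar : ∫ x, |f x - c| ^ 2 ∂τ ≤ Var[f; ν] := by
    rw [variance_eq_integral hf.aestronglyMeasurable.aemeasurable]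
    simp only [sq_abs]
    exact integral_mono_measure hτle (Filter.Eventually.of_forall fun x => sq_nonneg _)
      hg.integrable_sq
  have habs : -∫ x, (f x - c) ∂τ ≤ ∫ x, |f x - c| ∂τ :=
    (neg_le_abs _).trans abs_integral_le_integral_abs
  have h1 : ∫ x, f x ∂ν' - ν'.real univ * c ≤ ∫ x, |f x - c| ∂τ := by linarith
  refine h1.trans ?_
  simp only [one_mul, one_pow, integral_const, smul_eq_mul, mul_one, hmass] at hcs
  exact hcs.trans (by gcongr)

/-- Let `π` couple `μ'` with `ν`, and let `κ` be a part of `μ'`. Then `κ`, transported along `π`, is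
a part of `ν`, so that integrating a Lipschitz function against `κ` gives nearly `κ univ` times its
mean under `ν`. -/
lemma integral_sub_mul_le_of_coupling {X : Type*} [PseudoMetricSpace X] [MeasurableSpace X]
    [BorelSpace X] [SecondCountableTopology X] {μ' ν κ : Measure X} [IsProbabilityMeasure ν]
    (hκ : κ ≤ μ') {π : Measure (X × X)} (h1 : π.fst = μ') (h2 : π.snd = ν) {r : ℝ} (hr : 0 ≤ r)
    (hπ : ∫⁻ z, edist z.1 z.2 ∂π ≤ ENNReal.ofReal r) {K : ℝ≥0} {f : X → ℝ} (hf : LipschitzWith K f)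
    (hfν : MemLp f 2 ν) :
    ∫ x, f x ∂κ - κ.real univ * ∫ x, f x ∂ν
      ≤ K * r + √(1 - κ.real univ) * √(Var[f; ν]) := by
  have : IsProbabilityMeasure π := ⟨by rw [← Measure.snd_univ, h2]; exact measure_univ⟩
  obtain ⟨π', hπ', rfl⟩ := exists_le_fst_eq π κ (by rwa [h1])
  have : IsFiniteMeasure π' := isFiniteMeasure_of_le _ hπ'
  have hle : π'.snd ≤ ν := by rw [← h2]; exact Measure.map_mono hπ' measurable_snd
  have hmass : π'.snd.real univ = π'.fst.real univ := by
    simp [measureReal_def, Measure.fst_univ, Measure.snd_univ]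
  have hvar := integral_sub_mul_le_sqrt_variance ν π'.snd hle hfν
  rw [hmass] at hvar
  have hdint : Integrable (fun z : X × X => dist z.1 z.2) π := by
    refine ⟨(measurable_dist).aestronglyMeasurable, ?_⟩
    rw [hasFiniteIntegral_iff_norm]
    refine lt_of_le_of_lt ?_ (hπ.trans_lt ENNReal.ofReal_lt_top)
    simp [edist_dist]
  have hd : ∫ z, dist z.1 z.2 ∂π' ≤ r := by
    calc ∫ z, dist z.1 z.2 ∂π' ≤ ∫ z, dist z.1 z.2 ∂π :=
          integral_mono_measure hπ' (Filter.Eventually.of_forall fun z => dist_nonneg) hdint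
      _ ≤ r := by
          rw [integral_eq_lintegral_of_nonneg_ae (Filter.Eventually.of_forall fun z => dist_nonneg)
            hdint.aestronglyMeasurable]
          refine ENNReal.toReal_le_of_le_ofReal hr ?_
          simpa only [← edist_dist] using hπ
  have hfm : Measurable f := hf.continuous.measurable
  have hsnd : Integrable (fun z : X × X => f z.2) π' := by
    have := (hfν.integrable one_le_two).mono_measure hle
    exact (integrable_map_measure hfm.aestronglyMeasurable measurable_snd.aemeasurable).1 this
  have hdif : Integrable (fun z : X × X => f z.1 - f z.2) π' := by
    refine ((hdint.mono_measure hπ').const_mul (K : ℝ)).mono' ?_ ?_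
    · exact ((hfm.comp measurable_fst).sub (hfm.comp measurable_snd)).aestronglyMeasurable
    · exact Filter.Eventually.of_forall fun z => hf.dist_le_mul z.1 z.2
  have hfst : Integrable (fun z : X × X => f z.1) π' :=
    (hdif.add hsnd).congr (Filter.Eventually.of_forall fun z => sub_add_cancel _ _)
  have e1 : ∫ x, f x ∂π'.fst = ∫ z, f z.1 ∂π' :=
    integral_map measurable_fst.aemeasurable hfm.aestronglyMeasurable
  have e2 : ∫ x, f x ∂π'.snd = ∫ z, f z.2 ∂π' :=
    integral_map measurable_snd.aemeasurable hfm.aestronglyMeasurable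
  have hmove : ∫ x, f x ∂π'.fst - ∫ x, f x ∂π'.snd ≤ K * r := by
    rw [e1, e2, ← integral_sub hfst hsnd]
    calc ∫ z, (f z.1 - f z.2) ∂π' ≤ ∫ z, K * dist z.1 z.2 ∂π' := by
          refine integral_mono hdif ((hdint.mono_measure hπ').const_mul (K : ℝ)) fun z => ?_
          exact (le_abs_self _).trans (hf.dist_le_mul z.1 z.2)
      _ ≤ K * r := by rw [integral_const_mul]; gcongr
  linarith

/-! ### The robust Wasserstein distance -/

/-- The infima defining `robustWassersteinDist` are approached: a bound on it gives, for each larger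
radius, a measure close in total variation and a coupling of small cost. By Jensen, a bound for
`p ≥ 1` bounds the cost with exponent `1`. -/
lemma exists_coupling_of_robustWassersteinDist_le {X : Type*} [PseudoMetricSpace X]
    [MeasurableSpace X] [BorelSpace X] [SecondCountableTopology X] {p ε ρ r : ℝ} (hp : 1 ≤ p)
    {μt ν : ProbabilityMeasure X} (h : robustWassersteinDist p ε μt ν ≤ ENNReal.ofReal ρ)
    (hρ : 0 ≤ ρ) (hr : ρ < r) :
    ∃ (μ' : ProbabilityMeasure X) (π : Measure (X × X)), tvDist μ' μt ≤ ENNReal.ofReal ε ∧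
      π.fst = (μ' : Measure X) ∧ π.snd = (ν : Measure X) ∧
      ∫⁻ z, edist z.1 z.2 ∂π ≤ ENNReal.ofReal r := by
  have hlt : robustWassersteinDist p ε μt ν < ENNReal.ofReal r :=
    h.trans_lt ((ENNReal.ofReal_lt_ofReal_iff (hρ.trans_lt hr)).2 hr)
  simp only [robustWassersteinDist, wassersteinDist, iInf_lt_iff] at hlt
  obtain ⟨μ', htv, π, ⟨h1, h2⟩, hπ⟩ := hlt
  refine ⟨μ', π, htv, h1, h2, le_trans ?_ hπ.le⟩
  have : IsProbabilityMeasure π := ⟨by rw [← Measure.snd_univ, h2]; exact measure_univ⟩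
  have hjensen := eLpNorm'_le_eLpNorm'_of_exponent_le (μ := π)
    (f := fun z : X × X => dist z.1 z.2) zero_lt_one hp measurable_dist.aestronglyMeasurable
  have he (z : X × X) : ‖dist z.1 z.2‖ₑ = edist z.1 z.2 := by
    rw [edist_dist, Real.enorm_of_nonneg dist_nonneg]
  simpa [eLpNorm', he] using hjensen

/-- Two distributions within robust distance `ρ` of the same `μt` give nearly the same mean to a
Lipschitz function of variance at most `V`. The perturbations of `μt` witnessing the two distances
share a part of mass `m ≥ 1 - 2 * ε ≥ 1 / 50`, to which both means, scaled by `m`, are close. -/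
lemma integral_sub_le_of_robustWassersteinDist_le {X : Type*} [PseudoMetricSpace X]
    [MeasurableSpace X] [BorelSpace X] [SecondCountableTopology X] {p ε ρ : ℝ} (hp : 1 ≤ p)
    (hε : 0 ≤ ε) (hε' : ε ≤ 0.49) (hρ : 0 ≤ ρ) {μt μ ν : ProbabilityMeasure X}
    (hμ : robustWassersteinDist p ε μt μ ≤ ENNReal.ofReal ρ)
    (hν : robustWassersteinDist p ε μt ν ≤ ENNReal.ofReal ρ) {K : ℝ≥0} {f : X → ℝ}
    (hf : LipschitzWith K f) (hfμ : MemLp f 2 (μ : Measure X)) (hfν : MemLp f 2 (ν : Measure X))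
    {V : ℝ} (hVμ : Var[f; (μ : Measure X)] ≤ V) (hVν : Var[f; (ν : Measure X)] ≤ V) :
    ∫ x, f x ∂(ν : Measure X) - ∫ x, f x ∂(μ : Measure X) ≤ 100 * (K * ρ + √(2 * ε) * √V) := by
  refine le_of_forall_pos_le_add fun δ hδ => ?_
  -- Widening the radius by `t` costs `100 * K * t`, which is at most `δ`.
  set t : ℝ := δ / (100 * (K + 1)) with ht
  have hK : (0 : ℝ) ≤ K := K.2
  have htpos : 0 < t := by positivity
  have hKt : 100 * (K * t) ≤ δ := by
    have : 100 * ((K + 1) * t) = δ := by rw [ht]; field_simp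
    nlinarith
  obtain ⟨μ₁, π₁, htv₁, hfst₁, hsnd₁, hπ₁⟩ :=
    exists_coupling_of_robustWassersteinDist_le hp hμ hρ (lt_add_of_pos_right ρ htpos)
  obtain ⟨μ₂, π₂, htv₂, hfst₂, hsnd₂, hπ₂⟩ :=
    exists_coupling_of_robustWassersteinDist_le hp hν hρ (lt_add_of_pos_right ρ htpos)
  obtain ⟨κ, hκ₁, hκ₂, hm⟩ := exists_common_part (μ₁ : Measure X) (μ₂ : Measure X) (η := 2 * ε)
    fun A hA => by
      have a₁ := abs_le.1 (abs_measureReal_sub_le_of_tvDist_le hε htv₁ hA)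
      have a₂ := abs_le.1 (abs_measureReal_sub_le_of_tvDist_le hε htv₂ hA)
      linarith [a₁.2, a₂.1]
  have hr : 0 ≤ ρ + t := by positivity
  have b₂ := integral_sub_mul_le_of_coupling hκ₁ hfst₁ hsnd₁ hr hπ₁ hf hfμ
  have b₁ := integral_sub_mul_le_of_coupling hκ₂ hfst₂ hsnd₂ hr hπ₂ hf.neg hfν.neg
  simp only [Pi.neg_apply, integral_neg, variance_neg] at b₁
  set m := κ.real univ
  have hs : √(1 - m) ≤ √(2 * ε) := Real.sqrt_le_sqrt (by linarith)
  have c₂ : √(1 - m) * √(Var[f; (μ : Measure X)]) ≤ √(2 * ε) * √V := by gcongr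
  have c₁ : √(1 - m) * √(Var[f; (ν : Measure X)]) ≤ √(2 * ε) * √V := by gcongr
  set B := K * (ρ + t) + √(2 * ε) * √V with hB
  have hB0 : 0 ≤ B := by positivity
  set Δ := ∫ x, f x ∂(ν : Measure X) - ∫ x, f x ∂(μ : Measure X) with hΔ
  have hmΔ : m * Δ ≤ 2 * B := by rw [hΔ, hB]; linarith
  have hm' : 1 / 50 ≤ m := by norm_num at hε'; linarith
  have hΔB : Δ ≤ 100 * B := by
    by_contra! hcon
    nlinarith
  rw [hB] at hΔB
  linarith

/-! ### Distributions of bounded covariance -/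

/-- The coordinatewise mean of a distribution on `Z ⊆ ℝ^d`; it need not lie in `Z`. -/
noncomputable def meanVector {d : ℕ} {Z : Set (EuclideanSpace ℝ (Fin d))} (μ : ProbabilityMeasure Z) :
    EuclideanSpace ℝ (Fin d) :=
  WithLp.toLp 2 fun i => ∫ z : Z, (z : EuclideanSpace ℝ (Fin d)) i ∂(μ : Measure Z)

section BoundedCovariance

variable {d : ℕ} {Z : Set (EuclideanSpace ℝ (Fin d))} {μ ν : ProbabilityMeasure Z}

lemma memLp_coord (h : μ ∈ boundedCovClass Z) (i : Fin d) :
    MemLp (fun z : Z => (z : EuclideanSpace ℝ (Fin d)) i) 2 (μ : Measure Z) := by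
  refine h.1.mono (by fun_prop) (Filter.Eventually.of_forall fun z => ?_)
  exact PiLp.norm_apply_le (z : EuclideanSpace ℝ (Fin d)) i

lemma memLp_norm_sub (h : μ ∈ boundedCovClass Z) (a : EuclideanSpace ℝ (Fin d)) :
    MemLp (fun z : Z => ‖(z : EuclideanSpace ℝ (Fin d)) - a‖) 2 (μ : Measure Z) :=
  (h.1.sub (memLp_const a)).norm

/-- Taking traces in `Σ_μ ⪯ I_d`. -/
lemma integral_norm_sub_meanVector_sq_le (h : μ ∈ boundedCovClass Z) :
    ∫ z : Z, ‖(z : EuclideanSpace ℝ (Fin d)) - meanVector μ‖ ^ 2 ∂(μ : Measure Z) ≤ d := by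
  have htr : 0 ≤ (1 - covMatrix μ).trace := h.2.trace_nonneg
  rw [Matrix.trace_sub, Matrix.trace_one, Fintype.card_fin] at htr
  have hsum : ∫ z : Z, ‖(z : EuclideanSpace ℝ (Fin d)) - meanVector μ‖ ^ 2 ∂(μ : Measure Z)
      = (covMatrix μ).trace := by
    simp only [EuclideanSpace.norm_sq_eq, Real.norm_eq_abs, sq_abs, PiLp.sub_apply, meanVector]
    rw [integral_finsetSum]
    · refine Finset.sum_congr rfl fun i _ => ?_
      have hm := (memLp_coord h i).aestronglyMeasurable.aemeasurable
      rw [Matrix.diag_apply, covMatrix, Matrix.of_apply, covariance_self hm,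
        variance_eq_integral hm]
    · exact fun i _ => ((memLp_coord h i).sub (memLp_const _)).integrable_sq
  linarith

lemma memLp_of_lipschitzWith {F : Type*} [NormedAddCommGroup F] (h : μ ∈ boundedCovClass Z)
    {K : ℝ≥0} {f : Z → F} (hf : LipschitzWith K f)
    (hfm : AEStronglyMeasurable f (μ : Measure Z)) :
    MemLp f 2 (μ : Measure Z) := by
  obtain ⟨z₀⟩ := (μ : Measure Z).nonempty_of_neZero
  have hg : MemLp (fun z : Z => (K : ℝ) * ‖(z : EuclideanSpace ℝ (Fin d)) - z₀‖ + ‖f z₀‖) 2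
      (μ : Measure Z) := ((memLp_norm_sub h z₀).const_mul _).add (memLp_const _)
  refine hg.mono hfm (Filter.Eventually.of_forall fun z => ?_)
  have h1 : ‖f z - f z₀‖ ≤ K * ‖(z : EuclideanSpace ℝ (Fin d)) - z₀‖ := by
    simpa [dist_eq_norm, Subtype.dist_eq] using hf.dist_le_mul z z₀
  have h2 : ‖f z‖ ≤ ‖f z - f z₀‖ + ‖f z₀‖ := by simpa using norm_add_le (f z - f z₀) (f z₀)
  exact (h2.trans (by linarith)).trans (Real.le_norm_self _)

/-- A Lipschitz function is extended to `ℝ^d` in order to be centred at its value at the mean. -/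
lemma variance_le_of_lipschitzWith (h : μ ∈ boundedCovClass Z) {K : ℝ≥0} {f : Z → ℝ}
    (hf : LipschitzWith K f) : Var[f; (μ : Measure Z)] ≤ K ^ 2 * d := by
  have hfm : AEStronglyMeasurable f (μ : Measure Z) := hf.continuous.aestronglyMeasurable
  obtain ⟨F, hF, hFf⟩ : ∃ F : EuclideanSpace ℝ (Fin d) → ℝ,
      LipschitzWith K F ∧ ∀ z : Z, F z = f z := by
    have hon : LipschitzOnWith K (Function.extend Subtype.val f 0) Z := by
      rw [lipschitzOnWith_iff_restrict]
      convert hf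
      ext z
      exact Subtype.val_injective.extend_apply f 0 z
    obtain ⟨F, hF, hFf⟩ := hon.extend_real
    exact ⟨F, hF, fun z => by rw [← hFf z.2, Subtype.val_injective.extend_apply]⟩
  set c := F (meanVector μ)
  calc Var[f; (μ : Measure Z)] = Var[fun z => f z - c; (μ : Measure Z)] :=
        (variance_sub_const hfm c).symm
    _ ≤ ∫ z, (f z - c) ^ 2 ∂(μ : Measure Z) :=
        variance_le_expectation_sq (hfm.sub aestronglyMeasurable_const)
    _ ≤ ∫ z : Z, (K : ℝ) ^ 2 * ‖(z : EuclideanSpace ℝ (Fin d)) - meanVector μ‖ ^ 2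
          ∂(μ : Measure Z) := by
        refine integral_mono ((memLp_of_lipschitzWith h hf hfm).sub (memLp_const c)).integrable_sq
          ((memLp_norm_sub h _).integrable_sq.const_mul _) fun z => ?_
        have := hF.dist_le_mul z (meanVector μ)
        rw [Real.dist_eq, dist_eq_norm, hFf] at this
        calc (f z - c) ^ 2 = |f z - c| ^ 2 := (sq_abs _).symm
          _ ≤ (K * ‖(z : EuclideanSpace ℝ (Fin d)) - meanVector μ‖) ^ 2 := by gcongr
          _ = _ := mul_pow _ _ _
    _ ≤ K ^ 2 * d := by
        rw [integral_const_mul]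
        gcongr
        exact integral_norm_sub_meanVector_sq_le h

/-- The resilience of the bounded covariance class: distributions in it that are within robust
distance `ρ` of the same `μt` are at distance `O(ρ + √(d * ε))`, tested against Lipschitz
functions. -/
lemma integral_sub_le_of_mem_boundedCovClass {p ε ρ : ℝ} (hp : 1 ≤ p)
    (hε : 0 ≤ ε) (hε' : ε ≤ 0.49) (hρ : 0 ≤ ρ) (hμ : μ ∈ boundedCovClass Z)
    (hν : ν ∈ boundedCovClass Z) {μt : ProbabilityMeasure Z}
    (hμt : robustWassersteinDist p ε μt μ ≤ ENNReal.ofReal ρ)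
    (hνt : robustWassersteinDist p ε μt ν ≤ ENNReal.ofReal ρ) {K : ℝ≥0} {f : Z → ℝ}
    (hf : LipschitzWith K f) :
    ∫ x, f x ∂(ν : Measure Z) - ∫ x, f x ∂(μ : Measure Z) ≤ 200 * (K * (ρ + √(d * ε))) := by
  have hm (P : Measure Z) : AEStronglyMeasurable f P := hf.continuous.aestronglyMeasurable
  have h := integral_sub_le_of_robustWassersteinDist_le hp hε hε' hρ hμt hνt hf
    (memLp_of_lipschitzWith hμ hf (hm _)) (memLp_of_lipschitzWith hν hf (hm _))
    (variance_le_of_lipschitzWith hμ hf) (variance_le_of_lipschitzWith hν hf)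
  have hK : (0 : ℝ) ≤ K := K.2
  have h2 : √(2 * ε) * √((K : ℝ) ^ 2 * d) ≤ 2 * (K * √(d * ε)) := by
    have e : √(2 * ε) * √((K : ℝ) ^ 2 * d) = √2 * (K * √(d * ε)) := by
      rw [Real.sqrt_mul zero_le_two, Real.sqrt_mul (by positivity), Real.sqrt_sq hK,
        Real.sqrt_mul (by positivity)]
      ring
    rw [e]
    gcongr
    exact Real.sqrt_le_iff.2 ⟨by norm_num, by norm_num⟩
  have : 0 ≤ K * ρ := by positivity
  linarith

/-- The means are compared by testing with the linear functional in the direction of their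
difference. -/
lemma norm_meanVector_sub_le {p ε ρ : ℝ} (hp : 1 ≤ p)
    (hε : 0 ≤ ε) (hε' : ε ≤ 0.49) (hρ : 0 ≤ ρ) (hμ : μ ∈ boundedCovClass Z)
    (hν : ν ∈ boundedCovClass Z) {μt : ProbabilityMeasure Z}
    (hμt : robustWassersteinDist p ε μt μ ≤ ENNReal.ofReal ρ)
    (hνt : robustWassersteinDist p ε μt ν ≤ ENNReal.ofReal ρ) :
    ‖meanVector ν - meanVector μ‖ ≤ 200 * (ρ + √(d * ε)) := by
  set v := meanVector ν - meanVector μ with hv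
  have hmean {P : ProbabilityMeasure Z} (hP : P ∈ boundedCovClass Z) :
      ∫ z : Z, ⟪v, (z : EuclideanSpace ℝ (Fin d))⟫_ℝ ∂(P : Measure Z) = ⟪v, meanVector P⟫_ℝ := by
    simp only [PiLp.inner_apply, meanVector]
    rw [integral_finsetSum]
    · refine Finset.sum_congr rfl fun i _ => ?_
      simp only [RCLike.inner_apply, conj_trivial]
      rw [integral_mul_const]
    · intro i _
      simp only [RCLike.inner_apply, conj_trivial]
      exact ((memLp_coord hP i).integrable one_le_two).mul_const _
  have hlip : LipschitzWith ‖v‖₊ fun z : Z => ⟪v, (z : EuclideanSpace ℝ (Fin d))⟫_ℝ := by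
    refine LipschitzWith.of_dist_le_mul fun x y => ?_
    rw [Real.dist_eq, ← inner_sub_right, Subtype.dist_eq, dist_eq_norm]
    exact abs_real_inner_le_norm _ _
  have h := integral_sub_le_of_mem_boundedCovClass hp hε hε' hρ hμ hν hμt hνt hlip
  rw [hmean hμ, hmean hν, ← inner_sub_right, ← hv, real_inner_self_eq_norm_sq, coe_nnnorm] at h
  rcases (norm_nonneg v).eq_or_lt with h0 | h0
  · rw [← h0]; positivity
  · refine le_of_mul_le_mul_left ?_ h0
    linarith

/-- Under the independent coupling of `μ` and `ν`, the distance `‖y - x‖` is square integrable, and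
its second moment is controlled by the traces of the covariances and the distance of the means. -/
lemma integral_prod_norm_sub_sq_le (hμ : μ ∈ boundedCovClass Z) (hν : ν ∈ boundedCovClass Z) :
    MemLp (fun q : Z × Z => ‖(q.2 : EuclideanSpace ℝ (Fin d)) - q.1‖) 2
        ((μ : Measure Z).prod (ν : Measure Z)) ∧
      ∫ q : Z × Z, ‖(q.2 : EuclideanSpace ℝ (Fin d)) - q.1‖ ^ 2
        ∂(μ : Measure Z).prod (ν : Measure Z) ≤ 3 * (2 * d + ‖meanVector ν - meanVector μ‖ ^ 2) := by
  set P := (μ : Measure Z).prod (ν : Measure Z)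
  have hfst : MeasurePreserving Prod.fst P (μ : Measure Z) := measurePreserving_fst
  have hsnd : MeasurePreserving Prod.snd P (ν : Measure Z) := measurePreserving_snd
  have m1 : MemLp (fun q : Z × Z => ‖(q.1 : EuclideanSpace ℝ (Fin d)) - meanVector μ‖) 2 P :=
    (memLp_norm_sub hμ _).comp_measurePreserving hfst
  have m2 : MemLp (fun q : Z × Z => ‖(q.2 : EuclideanSpace ℝ (Fin d)) - meanVector ν‖) 2 P :=
    (memLp_norm_sub hν _).comp_measurePreserving hsnd
  have m : MemLp (fun q : Z × Z => ‖(q.2 : EuclideanSpace ℝ (Fin d)) - q.1‖) 2 P :=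
    ((hν.1.comp_measurePreserving hsnd).sub (hμ.1.comp_measurePreserving hfst)).norm
  have i1 : ∫ q : Z × Z, ‖(q.1 : EuclideanSpace ℝ (Fin d)) - meanVector μ‖ ^ 2 ∂P ≤ d := by
    have := integral_fun_fst (μ := (μ : Measure Z)) (ν := (ν : Measure Z))
      fun z : Z => ‖(z : EuclideanSpace ℝ (Fin d)) - meanVector μ‖ ^ 2
    simp only [probReal_univ, one_smul] at this
    rw [this]
    exact integral_norm_sub_meanVector_sq_le hμ
  have i2 : ∫ q : Z × Z, ‖(q.2 : EuclideanSpace ℝ (Fin d)) - meanVector ν‖ ^ 2 ∂P ≤ d := by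
    have := integral_fun_snd (μ := (μ : Measure Z)) (ν := (ν : Measure Z))
      fun z : Z => ‖(z : EuclideanSpace ℝ (Fin d)) - meanVector ν‖ ^ 2
    simp only [probReal_univ, one_smul] at this
    rw [this]
    exact integral_norm_sub_meanVector_sq_le hν
  refine ⟨m, ?_⟩
  set w := ‖meanVector ν - meanVector μ‖
  calc ∫ q : Z × Z, ‖(q.2 : EuclideanSpace ℝ (Fin d)) - q.1‖ ^ 2 ∂P
      ≤ ∫ q : Z × Z, (3 * ‖(q.1 : EuclideanSpace ℝ (Fin d)) - meanVector μ‖ ^ 2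
          + 3 * ‖(q.2 : EuclideanSpace ℝ (Fin d)) - meanVector ν‖ ^ 2 + 3 * w ^ 2) ∂P := by
        refine integral_mono m.integrable_sq (((m1.integrable_sq.const_mul 3).add
          (m2.integrable_sq.const_mul 3)).add (integrable_const _)) fun q => ?_
        set x := (q.1 : EuclideanSpace ℝ (Fin d))
        set y := (q.2 : EuclideanSpace ℝ (Fin d))
        have htri : ‖y - x‖ ≤ ‖x - meanVector μ‖ + ‖y - meanVector ν‖ + w := by
          have e : y - x = (y - meanVector ν) + (meanVector ν - meanVector μ)
            - (x - meanVector μ) := by abel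
          have := norm_sub_le ((y - meanVector ν) + (meanVector ν - meanVector μ))
            (x - meanVector μ)
          have := norm_add_le (y - meanVector ν) (meanVector ν - meanVector μ)
          rw [e]; linarith
        have hsq : ‖y - x‖ ^ 2 ≤ (‖x - meanVector μ‖ + ‖y - meanVector ν‖ + w) ^ 2 := by gcongr
        simp only
        nlinarith [sq_nonneg (‖x - meanVector μ‖ - ‖y - meanVector ν‖),
          sq_nonneg (‖x - meanVector μ‖ - w), sq_nonneg (‖y - meanVector ν‖ - w)]
    _ = 3 * ∫ q : Z × Z, ‖(q.1 : EuclideanSpace ℝ (Fin d)) - meanVector μ‖ ^ 2 ∂P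
          + 3 * ∫ q : Z × Z, ‖(q.2 : EuclideanSpace ℝ (Fin d)) - meanVector ν‖ ^ 2 ∂P
          + 3 * w ^ 2 := by
        have j1 := m1.integrable_sq.const_mul 3
        have j2 := m2.integrable_sq.const_mul 3
        have j12 : Integrable (fun q : Z × Z => 3 * ‖(q.1 : EuclideanSpace ℝ (Fin d))
            - meanVector μ‖ ^ 2 + 3 * ‖(q.2 : EuclideanSpace ℝ (Fin d)) - meanVector ν‖ ^ 2) P :=
          j1.add j2
        rw [integral_add j12 (integrable_const _), integral_add j1 j2, integral_const_mul,
          integral_const_mul]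
        simp
    _ ≤ 3 * (2 * d + w ^ 2) := by linarith

/-! ### Smooth functions -/

section Smooth

variable {α : ℝ≥0} {f : Z → ℝ} {g : Z → EuclideanSpace ℝ (Fin d)}

lemma IsSmoothWithGradient.lipschitzWith (h : IsSmoothWithGradient α f g) : LipschitzWith α g := by
  obtain ⟨F, D, -, hD, -, hlip⟩ := h
  refine LipschitzWith.of_dist_le_mul fun x y => ?_
  rw [← hD, ← hD]
  exact hlip.dist_le_mul x (subset_convexHull ℝ Z x.2) y (subset_convexHull ℝ Z y.2)

lemma IsSmoothWithGradient.continuous (h : IsSmoothWithGradient α f g) : Continuous f := by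
  obtain ⟨F, D, hF, -, hgrad, -⟩ := h
  have hc : ContinuousOn F Z := fun x hx =>
    ((hgrad x (subset_convexHull ℝ Z hx)).hasFDerivWithinAt.continuousWithinAt).mono
      (subset_convexHull ℝ Z)
  rw [continuousOn_iff_continuous_domRestrict] at hc
  convert hc
  ext z
  exact (hF z).symm

/-- First-order Taylor expansion, from the mean value theorem on the segment from `x` to `y`, which
lies in the convex hull of `Z`. -/
lemma IsSmoothWithGradient.abs_sub_sub_inner_le (h : IsSmoothWithGradient α f g) (x y : Z) :
    |f y - f x - ⟪g x, (y : EuclideanSpace ℝ (Fin d)) - x⟫_ℝ|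
      ≤ α * ‖(y : EuclideanSpace ℝ (Fin d)) - x‖ ^ 2 := by
  obtain ⟨F, D, hF, hD, hgrad, hlip⟩ := h
  have hx := subset_convexHull ℝ Z x.2
  have hy := subset_convexHull ℝ Z y.2
  obtain ⟨ξ, hξ, hmvt⟩ := domain_mvt (fun z hz => (hgrad z hz).hasFDerivWithinAt)
    (convex_convexHull ℝ Z) hx hy
  have hξhull := (convex_convexHull ℝ Z).segment_subset hx hy hξ
  have hdist : ‖ξ - x‖ ≤ ‖(y : EuclideanSpace ℝ (Fin d)) - x‖ := by
    have h1 := dist_add_dist_of_mem_segment hξ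
    rw [dist_eq_norm', dist_eq_norm', dist_eq_norm'] at h1
    linarith [norm_nonneg ((y : EuclideanSpace ℝ (Fin d)) - ξ)]
  have hDD : ‖D ξ - D x‖ ≤ α * ‖ξ - x‖ := by
    simpa [dist_eq_norm] using hlip.dist_le_mul ξ hξhull x hx
  rw [InnerProductSpace.toDual_apply_apply] at hmvt
  rw [← hF, ← hF, ← hD, hmvt, ← inner_sub_left]
  calc |⟪D ξ - D x, (y : EuclideanSpace ℝ (Fin d)) - x⟫_ℝ|
      ≤ ‖D ξ - D x‖ * ‖(y : EuclideanSpace ℝ (Fin d)) - x‖ := abs_real_inner_le_norm _ _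
    _ ≤ (α * ‖(y : EuclideanSpace ℝ (Fin d)) - x‖) * ‖(y : EuclideanSpace ℝ (Fin d)) - x‖ := by
        gcongr
        exact hDD.trans (by gcongr)
    _ = _ := by ring

lemma IsSmoothWithGradient.integrable (h : IsSmoothWithGradient α f g)
    (hμ : μ ∈ boundedCovClass Z) : Integrable f (μ : Measure Z) := by
  obtain ⟨z₀⟩ := (μ : Measure Z).nonempty_of_neZero
  have hn := memLp_norm_sub hμ z₀
  refine (((integrable_const |f z₀|).add ((hn.integrable one_le_two).const_mul ‖g z₀‖)).add
    (hn.integrable_sq.const_mul (α : ℝ))).mono' h.continuous.aestronglyMeasurable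
    (Filter.Eventually.of_forall fun z => ?_)
  have h1 := abs_le.1 (h.abs_sub_sub_inner_le z₀ z)
  have h2 := abs_le.1 (abs_real_inner_le_norm (g z₀) ((z : EuclideanSpace ℝ (Fin d)) - z₀))
  have h3 := neg_abs_le (f z₀)
  have h4 := le_abs_self (f z₀)
  simp only [Pi.add_apply, Real.norm_eq_abs]
  rw [abs_le]
  constructor <;> linarith [h1.1, h1.2, h2.1, h2.2]

/-- Taylor expansion along the independent coupling of `μ` and `ν`, followed by Cauchy–Schwarz. -/
lemma IsSmoothWithGradient.integral_sub_le (h : IsSmoothWithGradient α f g)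
    (hμ : μ ∈ boundedCovClass Z) (hν : ν ∈ boundedCovClass Z) {T : ℝ} (hT : 0 ≤ T)
    (hbd : 3 * (2 * d + ‖meanVector ν - meanVector μ‖ ^ 2) ≤ T ^ 2) :
    ∫ z, f z ∂(ν : Measure Z) - ∫ z, f z ∂(μ : Measure Z)
      ≤ sobolevSeminorm μ g * T + α * T ^ 2 := by
  obtain ⟨m, hm⟩ := integral_prod_norm_sub_sq_le hμ hν
  set P := (μ : Measure Z).prod (ν : Measure Z)
  have hfst : MeasurePreserving Prod.fst P (μ : Measure Z) := measurePreserving_fst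
  have hsnd : MeasurePreserving Prod.snd P (ν : Measure Z) := measurePreserving_snd
  have hg : MemLp (fun z => ‖g z‖) 2 (μ : Measure Z) :=
    (memLp_of_lipschitzWith hμ h.lipschitzWith h.lipschitzWith.continuous.aestronglyMeasurable).norm
  have hg1 : MemLp (fun q : Z × Z => ‖g q.1‖) 2 P := hg.comp_measurePreserving hfst
  have eμ := integral_fun_fst (μ := (μ : Measure Z)) (ν := (ν : Measure Z)) f
  have eν := integral_fun_snd (μ := (μ : Measure Z)) (ν := (ν : Measure Z)) f
  have eg := integral_fun_fst (μ := (μ : Measure Z)) (ν := (ν : Measure Z)) fun z => ‖g z‖ ^ 2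
  simp only [probReal_univ, one_smul] at eμ eν eg
  have iμ : Integrable (fun q : Z × Z => f q.1) P := (h.integrable hμ).comp_fst _
  have iν : Integrable (fun q : Z × Z => f q.2) P := (h.integrable hν).comp_snd _
  have ig : Integrable (fun q : Z × Z => ‖g q.1‖ * ‖(q.2 : EuclideanSpace ℝ (Fin d)) - q.1‖) P :=
    hg1.integrable_mul m
  rw [← eμ, ← eν, ← integral_sub iν iμ]
  have hcs := integral_mul_le_sqrt_mul_sqrt (fun q => norm_nonneg _) (fun q => norm_nonneg _) hg1 m
  calc ∫ q, (f q.2 - f q.1) ∂P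
      ≤ ∫ q : Z × Z, (‖g q.1‖ * ‖(q.2 : EuclideanSpace ℝ (Fin d)) - q.1‖
          + α * ‖(q.2 : EuclideanSpace ℝ (Fin d)) - q.1‖ ^ 2) ∂P := by
        refine integral_mono (iν.sub iμ) (ig.add (m.integrable_sq.const_mul _)) fun q => ?_
        have h1 := (abs_le.1 (h.abs_sub_sub_inner_le q.1 q.2)).2
        have h2 := real_inner_le_norm (g q.1) ((q.2 : EuclideanSpace ℝ (Fin d)) - q.1)
        simp only
        linarith
    _ = ∫ q : Z × Z, ‖g q.1‖ * ‖(q.2 : EuclideanSpace ℝ (Fin d)) - q.1‖ ∂P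
          + α * ∫ q : Z × Z, ‖(q.2 : EuclideanSpace ℝ (Fin d)) - q.1‖ ^ 2 ∂P := by
        rw [integral_add ig (m.integrable_sq.const_mul _), integral_const_mul]
    _ ≤ sobolevSeminorm μ g * T + α * T ^ 2 := by
        have hle := hm.trans hbd
        rw [eg] at hcs
        gcongr
        refine hcs.trans ?_
        rw [sobolevSeminorm]
        gcongr
        exact Real.sqrt_le_iff.2 ⟨hT, hle⟩

end Smooth

end BoundedCovariance

/-! ### Excess risk of the robust minimizer -/

lemma lipschitzWith_lipSeminorm {X : Type*} [PseudoMetricSpace X] {f : X → ℝ}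
    (h : ∃ K : ℝ≥0, LipschitzWith K f) : LipschitzWith (lipSeminorm f) f := by
  have hclosed : IsClosed {K : ℝ≥0 | LipschitzWith K f} := by
    simp only [lipschitzWith_iff_dist_le_mul, ofPred_forall]
    exact isClosed_iInter fun x => isClosed_iInter fun y =>
      isClosed_le continuous_const (by fun_prop)
  exact hclosed.csInf_mem h (OrderBot.bddBelow _)

lemma extExpectation_eq_integral {X : Type*} [MeasurableSpace X] {μ : ProbabilityMeasure X}
    {f : X → ℝ} (hf : Integrable f (μ : Measure X)) :
    extExpectation μ f = ((∫ x, f x ∂(μ : Measure X) : ℝ) : EReal) := by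
  have h1 : ∫⁻ x, ENNReal.ofReal (f x) ∂(μ : Measure X) ≠ ∞ := hf.lintegral_lt_top.ne
  have h2 : ∫⁻ x, ENNReal.ofReal (-f x) ∂(μ : Measure X) ≠ ∞ := hf.neg.lintegral_lt_top.ne
  rw [extExpectation, integral_eq_lintegral_pos_part_sub_lintegral_neg_part hf, EReal.coe_sub,
    EReal.coe_ennreal_toReal h1, EReal.coe_ennreal_toReal h2]

/-- If no feasible `ν` raises the mean of `ℓstar` by more than `B`, then the robust minimizer has
excess risk at most `B`: its risk under the feasible `μ` is at most its worst-case risk, hence at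
most the worst-case risk of `ℓstar`. -/
lemma IsORWDROMinimizer.extExpectation_sub_le {X : Type*} [PseudoEMetricSpace X]
    [MeasurableSpace X] {p ρ ε B : ℝ} {L : Set (X → ℝ)} {G : Set (ProbabilityMeasure X)}
    {μ μt : ProbabilityMeasure X} {ℓhat ℓstar : X → ℝ} (h : IsORWDROMinimizer p ρ ε L G μt ℓhat)
    (hL : ℓstar ∈ L) (hμ : μ ∈ G) (hμt : robustWassersteinDist p ε μt μ ≤ ENNReal.ofReal ρ)
    (hint : ∀ ν ∈ G, Integrable ℓstar (ν : Measure X))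
    (hB : ∀ ν ∈ G, robustWassersteinDist p ε μt ν ≤ ENNReal.ofReal ρ →
      ∫ x, ℓstar x ∂(ν : Measure X) - ∫ x, ℓstar x ∂(μ : Measure X) ≤ B) :
    extExpectation μ ℓhat - extExpectation μ ℓstar ≤ (B : EReal) := by
  refine EReal.sub_le_of_le_add ?_
  calc extExpectation μ ℓhat ≤ worstCaseRisk p ρ ε G μt ℓhat :=
        le_iSup₂ (f := fun (ν : ProbabilityMeasure X)
          (_ : ν ∈ G ∧ robustWassersteinDist p ε μt ν ≤ ENNReal.ofReal ρ) =>
            extExpectation ν ℓhat) μ ⟨hμ, hμt⟩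
    _ ≤ worstCaseRisk p ρ ε G μt ℓstar := h.2 ℓstar hL
    _ ≤ B + extExpectation μ ℓstar := by
        refine iSup₂_le fun ν hν => ?_
        rw [extExpectation_eq_integral (hint ν hν.1), extExpectation_eq_integral (hint μ hμ),
          ← EReal.coe_add, EReal.coe_le_coe_iff]
        linarith [hB ν hν.1 hν.2]

theorem mainTheorem2 :
    ∃ C : ℝ, 0 < C ∧
      ∀ (d : ℕ) (Z : Set (EuclideanSpace ℝ (Fin d))), IsClosed Z → Z.Nonempty →
      ∀ (ρ ε : ℝ), 0 ≤ ρ → 0 ≤ ε → ε ≤ 0.49 →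
      ∀ (L : Set (Z → ℝ)) (G : Set (ProbabilityMeasure Z)), G ⊆ boundedCovClass Z →
      ∀ (μ μt : ProbabilityMeasure Z), μ ∈ G →
      ∀ (ℓhat ℓstar : Z → ℝ), IsRiskMinimizer L μ ℓstar →
        (IsLossFamily 1 L →
          robustWassersteinDist 1 ε μt μ ≤ ENNReal.ofReal ρ →
          IsORWDROMinimizer 1 ρ ε L G μt ℓhat →
          (∃ K : ℝ≥0, LipschitzWith K ℓstar) →
          extExpectation μ ℓhat - extExpectation μ ℓstar ≤
            ((C * (lipSeminorm ℓstar * (ρ + Real.sqrt (d * ε))) : ℝ) : EReal)) ∧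
        (IsLossFamily 2 L →
          robustWassersteinDist 2 ε μt μ ≤ ENNReal.ofReal ρ →
          IsORWDROMinimizer 2 ρ ε L G μt ℓhat →
          ∀ (α : ℝ≥0) (g : Z → EuclideanSpace ℝ (Fin d)), IsSmoothWithGradient α ℓstar g →
          extExpectation μ ℓhat - extExpectation μ ℓstar ≤
            ((C * (sobolevSeminorm μ g * (ρ + Real.sqrt d) + α * (ρ ^ 2 + d)) : ℝ) : EReal)) := by
  refine ⟨320000, by norm_num, ?_⟩
  intro d Z _ _ ρ ε hρ hε hε' L G hG μ μt hμ ℓhat ℓstar hstar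
  refine ⟨fun _ hμt hmin hlip => ?_, fun _ hμt hmin α g hsm => ?_⟩
  · have hK := lipschitzWith_lipSeminorm hlip
    refine hmin.extExpectation_sub_le hstar.1 hμ hμt (fun ν hν => ?_) fun ν hν hνt => ?_
    · exact (memLp_of_lipschitzWith (hG hν) hK
        hK.continuous.aestronglyMeasurable).integrable one_le_two
    · refine (integral_sub_le_of_mem_boundedCovClass le_rfl hε hε' hρ (hG hμ) (hG hν) hμt hνt
        hK).trans ?_
      gcongr
      norm_num
  · refine hmin.extExpectation_sub_le hstar.1 hμ hμt (fun ν hν => hsm.integrable (hG hν))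
      fun ν hν hνt => ?_
    set R := ρ + √d with hR
    have hd : √(d : ℝ) ^ 2 = d := Real.sq_sqrt (Nat.cast_nonneg d)
    have hd0 : 0 ≤ √(d : ℝ) := Real.sqrt_nonneg _
    have hmean : ‖meanVector ν - meanVector μ‖ ≤ 200 * R := by
      refine (norm_meanVector_sub_le one_le_two hε hε' hρ (hG hμ) (hG hν) hμt hνt).trans ?_
      have hε1 : ε ≤ 1 := by norm_num at hε'; linarith
      have hdε : √(d * ε) ≤ √d :=
        Real.sqrt_le_sqrt (mul_le_of_le_one_right (Nat.cast_nonneg d) hε1)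
      rw [hR]
      gcongr
    have hmean2 : ‖meanVector ν - meanVector μ‖ ^ 2 ≤ (200 * R) ^ 2 := by gcongr
    have hdR : (d : ℝ) ≤ R ^ 2 := by rw [hR]; nlinarith
    have hR2 : R ^ 2 ≤ 2 * (ρ ^ 2 + d) := by rw [hR]; nlinarith [sq_nonneg (ρ - √d)]
    -- The second moment of the independent coupling is at most
    -- `3 * (2 * d + (200 * R) ^ 2) ≤ (400 * R) ^ 2`.
    refine (hsm.integral_sub_le (hG hμ) (hG hν) (T := 400 * R) (by positivity)
      (by nlinarith)).trans ?_
    have hS : 0 ≤ sobolevSeminorm μ g * R := mul_nonneg (Real.sqrt_nonneg _) (by positivity)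
    have hα : α * R ^ 2 ≤ α * (2 * (ρ ^ 2 + d)) := by gcongr
    linarith
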